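/- Let $\mathcal H$ be a separable complex Hilbert space and let $S$ be a densely defined closed symmetric operator in $\mathcal H$ with equal infinite deficiency indices, i.e. $\dim\ker(S^*-i)=\dim\ker(S^*+i)=\infty$, and assume that $S$ has a self-adjoint extension in $\mathcal H$ with compact resolvent. Let $\mathcal G$ be a separable infinite-dimensional complex Hilbert space and let $\Xi$ be a self-adjoint operator in $\mathcal G$ with $\mathbb R\cap\rho(\Xi)\neq\emptyset$. Then there exists a self-adjoint extension $A$ of $S$ in $\mathcal H$ such that $$\sigma_{\rm ess}(A)=\sigma_{\rm ess}(\Xi).$$ Here, for a self-adjoint operator $T$, $\sigma_{\rm ess}(T)$ is the set of all points of $\sigma(T)$ that are not isolated points of $\sigma(T)$ which are eigenvalues with finite-dimensional eigenspace. More precisely, let $A_0$ be any self-adjoint extension of $S$ in $\mathcal H$ with compact resolvent. Then $\mathbb R\cap\rho(A_0)\cap\rho(\Xi)\ne\emptyset$, and for every $\mu\in\mathbb R\cap\rho(A_0)\cap\rho(\Xi)$ the following holds. One has the orthogonal sum decomposition $\mathcal H=\ker(S^*-\mu)\oplus\operatorname{ran}(S-\mu)$; there exist unitary operators $U:\mathcal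 G\to\ker(S^*-\mu)$; and for every such $U$ there is a self-adjoint extension $A$ of $S$ in $\mathcal H$ with $\mu\in\rho(A)$, $$(A-\mu)^{-1}=(A_0-\mu)^{-1}+\begin{pmatrix}U(\Xi-\mu)^{-1}U^{-1}&0\\0&0\end{pmatrix}$$ with respect to this decomposition, and $\sigma_{\rm ess}(A)=\sigma_{\rm ess}(\Xi)$. -/

import Mathlib

open scoped Topology

namespace HilbertOp

variable {H : Type*} [NormedAddCommGroup H] [InnerProductSpace ℂ H]
variable {G : Type*} [NormedAddCommGroup G] [InnerProductSpace ℂ G]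

/-- The kernel `ker (T - z)` of an operator `T` with domain in `H`, as a subspace of `H`:
all `x ∈ dom T` with `T x = z x`. -/
def kerSub (T : H →ₗ.[ℂ] H) (z : ℂ) : Submodule ℂ H where
  carrier := {x | ∃ hx : x ∈ T.domain, T ⟨x, hx⟩ = z • x}
  zero_mem' := ⟨T.domain.zero_mem, by
    rw [smul_zero]; exact T.map_zero⟩
  add_mem' := by
    rintro x y ⟨hx, hx'⟩ ⟨hy, hy'⟩
    refine ⟨T.domain.add_mem hx hy, ?_⟩
    rw [smul_add, ← hx', ← hy']
    exact T.map_add ⟨x, hx⟩ ⟨y, hy⟩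
  smul_mem' := by
    rintro c x ⟨hx, hx'⟩
    refine ⟨T.domain.smul_mem c hx, ?_⟩
    rw [smul_comm, ← hx']
    exact T.map_smul c ⟨x, hx⟩

/-- The range `ran (T - z)` of `T - z`, whose domain is `dom T`. -/
def ranSub (T : H →ₗ.[ℂ] H) (z : ℂ) : Submodule ℂ H :=
  LinearMap.range (T.toFun - z • T.domain.subtype)

/-- `R` is a bounded, everywhere defined, two-sided inverse of `T - z : dom T → H`. -/
def IsResolventAt (T : H →ₗ.[ℂ] H) (z : ℂ) (R : H →L[ℂ] H) : Prop :=
  (∀ h : H, ∃ hR : R h ∈ T.domain, T ⟨R h, hR⟩ - z • R h = h) ∧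
    ∀ x : T.domain, R (T x - z • (x : H)) = x

/-- The resolvent set `ρ(T)`. -/
def resolventSet (T : H →ₗ.[ℂ] H) : Set ℂ := {z | ∃ R : H →L[ℂ] H, IsResolventAt T z R}

/-- The spectrum `σ(T) = ℂ \ ρ(T)`. -/
def spec (T : H →ₗ.[ℂ] H) : Set ℂ := (resolventSet T)ᶜ

open scoped Classical in
/-- The resolvent `(T - z)⁻¹`, for `z ∈ ρ(T)` (and `0` for other `z`). -/
noncomputable def resolvent (T : H →ₗ.[ℂ] H) (z : ℂ) : H →L[ℂ] H :=
  if h : ∃ R : H →L[ℂ] H, IsResolventAt T z R then h.choose else 0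

theorem isResolventAt_resolvent {T : H →ₗ.[ℂ] H} {z : ℂ} (hz : z ∈ resolventSet T) :
    IsResolventAt T z (resolvent T z) := by
  have hz' : ∃ R : H →L[ℂ] H, IsResolventAt T z R := hz
  rw [resolvent, dif_pos hz']
  exact hz'.choose_spec

theorem IsResolventAt.eq_resolvent {T : H →ₗ.[ℂ] H} {z : ℂ} {R : H →L[ℂ] H}
    (hR : IsResolventAt T z R) : R = resolvent T z := by
  ext h
  obtain ⟨hx, hh⟩ := hR.1 h
  have := (isResolventAt_resolvent ⟨R, hR⟩).2 ⟨R h, hx⟩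
  rw [hh] at this
  exact this.symm

/-- `T` has compact resolvent: `(T - z)⁻¹` is a compact operator for some `z ∈ ρ(T)`
(equivalently, by the resolvent identity, `ρ(T)` is nonempty and this holds for all `z ∈ ρ(T)`). -/
def HasCompactResolvent (T : H →ₗ.[ℂ] H) : Prop :=
  ∃ z ∈ resolventSet T, IsCompactOperator (resolvent T z)

/-- The discrete spectrum: isolated points of `σ(T)` which are eigenvalues with a
finite dimensional eigenspace. -/
def discSpec (T : H →ₗ.[ℂ] H) : Set ℂ :=
  {z | z ∈ spec T ∧ (∃ N ∈ 𝓝 z, N ∩ spec T = {z}) ∧ kerSub T z ≠ ⊥ ∧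
    FiniteDimensional ℂ (kerSub T z)}

/-- The essential spectrum: the complement of the discrete spectrum in the spectrum. -/
def essSpec (T : H →ₗ.[ℂ] H) : Set ℂ := spec T \ discSpec T

/-- `dim ker (S* - z)` as an element of `ℕ ∪ {∞}`. The deficiency indices of `S` are the values
at `z = i` and `z = -i`. -/
noncomputable def deficiencyIndex [CompleteSpace H] (S : H →ₗ.[ℂ] H) (z : ℂ) : ℕ∞ :=
  Cardinal.toENat (Module.rank ℂ (kerSub S.adjoint z))

/-- `D` is the operator in `H` with block matrix `[B, 0; 0, 0]` with respect to the decomposition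
`H = K ⊕ L`, where the operator `B` in `G` is regarded as an operator in `K` by means of the
unitary `U : G → K`. -/
def IsCornerBlock (K L : Submodule ℂ H) (U : G ≃ₗᵢ[ℂ] K) (B : G →L[ℂ] G) (D : H →L[ℂ] H) : Prop :=
  (∀ k : K, D k = U (B (U.symm k))) ∧ ∀ l ∈ L, D l = 0

end HilbertOp

/-!
A point `z` lies outside `σ_ess(T)` if and only if `1 - (z - w) (T - w)⁻¹` has a left inverse modulo
compact operators, provided that `(T - w)⁻¹` is normal. This property is stable under compact
perturbations of `(T - w)⁻¹`, and it is inherited by `1 - X Y` from `1 - Y X`. Let `V : G → H` be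
the isometry given by `U`. As `(A₀ - μ)⁻¹` is compact, an operator `A` with
`(A - μ)⁻¹ = (A₀ - μ)⁻¹ + V (Ξ - μ)⁻¹ V†` has the same essential spectrum as `Ξ`. It extends `S`
because `V†` vanishes on `ran (S - μ)`.
-/

open Filter ContinuousLinearMap

namespace HilbertOp

section LeftFredholm

variable {𝕜 E F : Type*} [NontriviallyNormedField 𝕜] [NormedAddCommGroup E] [NormedSpace 𝕜 E]
  [NormedAddCommGroup F] [NormedSpace 𝕜 F]

/-- A bounded operator is left Fredholm if it has a left inverse modulo compact operators. The left
inverse is only asked to exist, so that no Calkin algebra is needed. -/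
def IsLeftFredholm (A : E →L[𝕜] F) : Prop :=
  ∃ B : F →L[𝕜] E, IsCompactOperator (B ∘L A - 1 : E →L[𝕜] E)

theorem IsLeftFredholm.of_isUnit {A : E →L[𝕜] E} (hA : IsUnit A) : IsLeftFredholm A := by
  obtain ⟨B, hBA⟩ := hA.exists_left_inv
  refine ⟨B, ?_⟩
  rw [← mul_def, hBA, sub_self]
  exact isCompactOperator_zero

theorem IsLeftFredholm.of_isCompactOperator_sub {A A' : E →L[𝕜] F} (hA : IsLeftFredholm A)
    (h : IsCompactOperator (A' - A : E →L[𝕜] F)) : IsLeftFredholm A' := by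
  obtain ⟨B, hB⟩ := hA
  refine ⟨B, ?_⟩
  have hsplit : B ∘L A' - 1 = (B ∘L A - 1) + B ∘L (A' - A) := by rw [comp_sub]; abel
  rw [hsplit]
  exact hB.add (h.clm_comp B)

theorem isLeftFredholm_congr {A A' : E →L[𝕜] F} (h : IsCompactOperator (A - A' : E →L[𝕜] F)) :
    IsLeftFredholm A ↔ IsLeftFredholm A' := by
  refine ⟨fun hA => hA.of_isCompactOperator_sub ?_, fun hA' => hA'.of_isCompactOperator_sub h⟩
  rw [← neg_sub]
  exact h.neg

/-- The left inverse is the one of Jacobson's lemma. -/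
theorem IsLeftFredholm.one_sub_comp {X : E →L[𝕜] F} {Y : F →L[𝕜] E}
    (h : IsLeftFredholm (1 - Y ∘L X)) : IsLeftFredholm (1 - X ∘L Y) := by
  obtain ⟨B, hB⟩ := h
  refine ⟨1 + X ∘L B ∘L Y, ?_⟩
  have hconj : (1 + X ∘L B ∘L Y) ∘L (1 - X ∘L Y) - 1 = X ∘L (B ∘L (1 - Y ∘L X) - 1) ∘L Y := by
    ext x
    simp only [comp_apply, add_apply, sub_apply, one_apply_eq_self, map_sub]
    abel
  rw [hconj]
  exact (hB.comp_clm Y).clm_comp X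

theorem isLeftFredholm_one_sub_comp_comm (X : E →L[𝕜] F) (Y : F →L[𝕜] E) :
    IsLeftFredholm (1 - X ∘L Y) ↔ IsLeftFredholm (1 - Y ∘L X) :=
  ⟨IsLeftFredholm.one_sub_comp, IsLeftFredholm.one_sub_comp⟩

theorem IsLeftFredholm.finiteDimensional_ker [CompleteSpace 𝕜] {A : E →L[𝕜] F}
    (hA : IsLeftFredholm A) : FiniteDimensional 𝕜 A.ker := by
  obtain ⟨B, hB⟩ := hA
  have hid : IsCompactOperator (A.ker.subtypeL : A.ker → E) := by
    have hneg : (A.ker.subtypeL : A.ker → E) = -((B ∘L A - 1 : E →L[𝕜] E) ∘ A.ker.subtypeL) := by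
      ext x
      simp
    rw [hneg]
    exact (hB.comp_clm A.ker.subtypeL).neg
  exact FiniteDimensional.of_isCompactOperator_id (𝕜 := 𝕜)
    (hid.codRestrict (fun x => x.2) A.isClosed_ker)

theorem exists_seq_tendsto_zero_of_not_antilipschitz {A : E →L[𝕜] F}
    (hA : ¬ ∃ K, AntilipschitzWith K A) :
    ∃ δ > 0, ∃ x : ℕ → E, (∀ n, δ ≤ ‖x n‖ ∧ ‖x n‖ ≤ 1) ∧
      Tendsto (fun n => A (x n)) atTop (𝓝 0) := by
  rw [antilipschitzWith_iff_exists_mul_le_norm] at hA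
  push Not at hA
  obtain ⟨c, hc⟩ := NormedField.exists_one_lt_norm 𝕜
  obtain ⟨ε, -, hεpos, hε⟩ := exists_seq_strictAnti_tendsto (0 : ℝ)
  have hshell : ∀ n, ∃ x : E, (‖c‖⁻¹ ≤ ‖x‖ ∧ ‖x‖ ≤ 1) ∧ ‖A x‖ ≤ ε n := by
    intro n
    obtain ⟨x, hx⟩ := hA (ε n) (hεpos n)
    have hx0 : x ≠ 0 := by rintro rfl; simp at hx
    obtain ⟨a, -, ha1, hac, -⟩ := rescale_to_shell hc one_pos hx0
    refine ⟨a • x, ⟨by simpa using hac, ha1.le⟩, ?_⟩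
    calc ‖A (a • x)‖ = ‖a‖ * ‖A x‖ := by rw [map_smul, norm_smul]
      _ ≤ ‖a‖ * (ε n * ‖x‖) := by gcongr
      _ = ε n * ‖a • x‖ := by rw [norm_smul]; ring
      _ ≤ ε n := mul_le_of_le_one_right (hεpos n).le ha1.le
  choose x hx hAx using hshell
  exact ⟨‖c‖⁻¹, by positivity, x, hx, squeeze_zero_norm hAx hε⟩

/-- If `A xₙ → 0` and `B A = 1 + K`, then `xₙ + K xₙ → 0`, so that `xₙ` has a limit point, which
lies in the kernel of `A`. -/
theorem IsLeftFredholm.exists_antilipschitzWith {A : E →L[𝕜] F} (hA : IsLeftFredholm A)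
    (hinj : Function.Injective A) : ∃ K, AntilipschitzWith K A := by
  obtain ⟨B, hB⟩ := hA
  by_contra hnot
  obtain ⟨δ, hδ, x, hx, hAx⟩ := exists_seq_tendsto_zero_of_not_antilipschitz hnot
  obtain ⟨C, hC, hsub⟩ := hB.image_closedBall_subset_compact 1
  obtain ⟨y, -, φ, hφ, hKx⟩ := hC.tendsto_subseq
    (fun n => hsub ⟨x n, by simpa using (hx n).2, rfl⟩)
  have hAxφ : Tendsto (fun n => A (x (φ n))) atTop (𝓝 0) := hAx.comp hφ.tendsto_atTop
  have hxy : Tendsto (fun n => x (φ n)) atTop (𝓝 (-y)) := by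
    have hBAx := (B.continuous.tendsto 0).comp hAxφ
    simpa [Function.comp_def] using hBAx.sub hKx
  have hAy : A (-y) = A 0 := by
    rw [map_zero]
    exact tendsto_nhds_unique ((A.continuous.tendsto _).comp hxy) hAxφ
  have hδy : δ ≤ ‖-y‖ := ge_of_tendsto' hxy.norm fun n => (hx (φ n)).1
  rw [hinj hAy, norm_zero] at hδy
  exact hδ.not_ge hδy

end LeftFredholm

section FiniteRank

variable {𝕜 E F : Type*} [NontriviallyNormedField 𝕜] [LocallyCompactSpace 𝕜]
  [NormedAddCommGroup E] [NormedSpace 𝕜 E] [NormedAddCommGroup F] [NormedSpace 𝕜 F]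

theorem isCompactOperator_of_forall_mem {A : E →L[𝕜] F} (V : Submodule 𝕜 F)
    [FiniteDimensional 𝕜 V] (h : ∀ x, A x ∈ V) : IsCompactOperator A :=
  have : ProperSpace V := FiniteDimensional.proper 𝕜 V
  (isCompactOperator_of_locallyCompactSpace_dom (A.codRestrict V h)).clm_comp V.subtypeL

theorem isLeftFredholm_of_comp_comp_self {A : E →L[𝕜] F} {B : F →L[𝕜] E} (h : A ∘L B ∘L A = A)
    [FiniteDimensional 𝕜 A.ker] : IsLeftFredholm A := by
  refine ⟨B, isCompactOperator_of_forall_mem A.ker fun x => ?_⟩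
  have hx : A (B (A x)) = A x := congrArg (fun L : E →L[𝕜] F => L x) h
  simp [hx]

end FiniteRank

section Normal

variable {𝕜 H : Type*} [RCLike 𝕜] [NormedAddCommGroup H] [InnerProductSpace 𝕜 H] [CompleteSpace H]

theorem IsLeftFredholm.isUnit_of_injective {F : H →L[𝕜] H} (hF : IsLeftFredholm F)
    (hnormal : IsStarNormal F) (hinj : Function.Injective F) : IsUnit F := by
  have hrange : F.rangeᗮ = ⊥ := by
    rw [hnormal.orthogonal_range]
    exact LinearMap.ker_eq_bot.mpr hinj
  rw [isUnit_iff_bijective, bijective_iff_dense_range_and_antilipschitz]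
  exact ⟨Submodule.topologicalClosure_eq_top_iff.mpr hrange, hF.exists_antilipschitzWith hinj⟩

theorem starProjection_ker_mul_self {F : H →L[𝕜] H} (hnormal : IsStarNormal F)
    [F.ker.HasOrthogonalProjection] : F.ker.starProjection * F = 0 := by
  have hstar : star F * F.ker.starProjection = 0 := by
    ext x
    exact (hnormal.adjoint_apply_eq_zero_iff _).mpr (F.ker.starProjection_apply_mem x)
  simpa [(isSelfAdjoint_starProjection F.ker).star_eq] using congrArg star hstar

theorem IsLeftFredholm.isUnit_add_starProjection_ker {F : H →L[𝕜] H} (hF : IsLeftFredholm F)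
    (hnormal : IsStarNormal F) [FiniteDimensional 𝕜 F.ker] :
    IsUnit (F + F.ker.starProjection) := by
  set P := F.ker.starProjection
  have hP : IsSelfAdjoint P := isSelfAdjoint_starProjection F.ker
  have hFP : F * P = 0 := by
    ext x
    exact F.ker.starProjection_apply_mem x
  have hPF : P * F = 0 := starProjection_ker_mul_self hnormal
  have hcompact : IsCompactOperator P :=
    isCompactOperator_of_forall_mem F.ker F.ker.starProjection_apply_mem
  have hsum : IsLeftFredholm (F + P) := hF.of_isCompactOperator_sub (by simpa using hcompact)
  have hsumNormal : IsStarNormal (F + P) := by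
    have := hP.isStarNormal
    refine Commute.isStarNormal_add ?_
    rw [hP.star_eq, commute_iff_eq, hFP, hPF]
  refine hsum.isUnit_of_injective hsumNormal ((injective_iff_map_eq_zero _).mpr fun x hx => ?_)
  have hPx : P x = 0 := by
    have hPP : P * (F + P) = P := by
      rw [mul_add, hPF, zero_add, F.ker.isIdempotentElem_starProjection]
    rw [← hPP, mul_apply_eq_comp, hx, map_zero]
  have hFx : x ∈ F.ker := by simpa [hPx] using hx
  rw [← hPx]
  exact (F.ker.starProjection_eq_self_iff.mpr hFx).symm

/-- With `P` the projection onto the finite-dimensional kernel of `1 - c R`, the operator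
`1 - c' R + P` is invertible at `c' = c`, hence nearby. There, `1 - c' R` is left Fredholm, and it
is injective for `c' ≠ c` because `c P (1 - c' R) = (c - c') P`. -/
theorem IsLeftFredholm.eventually_isUnit_one_sub_smul {R : H →L[𝕜] H} (hR : IsStarNormal R)
    {c : 𝕜} (h : IsLeftFredholm (1 - c • R)) : ∀ᶠ c' in 𝓝[≠] c, IsUnit (1 - c' • R) := by
  have hnormal : ∀ c' : 𝕜, IsStarNormal (1 - c' • R) := fun c' => inferInstance
  have hfin : FiniteDimensional 𝕜 (1 - c • R).ker := h.finiteDimensional_ker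
  have hunit := h.isUnit_add_starProjection_ker (hnormal c)
  have hcompact : IsCompactOperator (1 - c • R).ker.starProjection :=
    isCompactOperator_of_forall_mem _ (1 - c • R).ker.starProjection_apply_mem
  set P := (1 - c • R).ker.starProjection
  have hPR : P = c • (P * R) := by
    have hPF : P * (1 - c • R) = 0 := starProjection_ker_mul_self (hnormal c)
    rwa [mul_sub, mul_one, mul_smul_comm, sub_eq_zero] at hPF
  have hnear : ∀ᶠ c' in 𝓝 c, IsUnit (1 - c' • R + P) := by
    have hcont : Continuous fun c' : 𝕜 => 1 - c' • R + P := by fun_prop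
    exact hcont.continuousAt.eventually_mem (Units.isOpen.mem_nhds hunit)
  filter_upwards [nhdsWithin_le_nhds hnear, self_mem_nhdsWithin] with c' hc' hne
  have hleft : IsLeftFredholm (1 - c' • R) :=
    (IsLeftFredholm.of_isUnit hc').of_isCompactOperator_sub (by simpa using hcompact.neg)
  refine hleft.isUnit_of_injective (hnormal c') ((injective_iff_map_eq_zero _).mpr fun x hx => ?_)
  have hRx : c' • R x = x := (sub_eq_zero.mp hx).symm
  have hcPx : c' • P x = c • P x := calc
    c' • P x = c' • c • P (R x) := congrArg (c' • ·) (congrArg (fun L : H →L[𝕜] H => L x) hPR)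
    _ = c • P (c' • R x) := by rw [map_smul, smul_comm]
    _ = c • P x := by rw [hRx]
  have hPx : P x = 0 := by
    refine (smul_eq_zero.mp ?_).resolve_left (sub_ne_zero.mpr hne)
    rw [sub_smul, hcPx, sub_self]
  refine (isUnit_iff_bijective.mp hc').injective ?_
  rw [add_apply, hx, hPx, map_zero, add_zero]

end Normal

section Isolated

theorem isUnit_one_sub_smul_iff {𝕜 A : Type*} [Field 𝕜] [Ring A] [Algebra 𝕜 A] {c : 𝕜}
    (hc : c ≠ 0) (a : A) : IsUnit (1 - c • a) ↔ c⁻¹ ∉ spectrum 𝕜 a := by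
  have hscale : 1 - c • a = Units.mk0 c hc • (algebraMap 𝕜 A c⁻¹ - a) := by
    rw [Units.smul_mk0, smul_sub, Algebra.algebraMap_eq_smul_one, smul_inv_smul₀ hc]
  rw [spectrum.notMem_iff, hscale, isUnit_smul_iff]

theorem continuousOn_inv_one_sub_mul_spectrum {𝕜 A : Type*} [NontriviallyNormedField 𝕜]
    [Ring A] [Algebra 𝕜 A] {a : A} {c : 𝕜} (h : ∀ᶠ c' in 𝓝[≠] c, IsUnit (1 - c' • a)) :
    ContinuousOn (fun ζ : 𝕜 => (1 - c * ζ)⁻¹) (spectrum 𝕜 a) := by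
  intro ζ _
  rcases ne_or_eq (1 - c * ζ) 0 with hne | hzero
  · exact (ContinuousAt.inv₀ (f := fun ζ => 1 - c * ζ) (by fun_prop) hne).continuousWithinAt
  refine continuousWithinAt_of_not_accPt ?_
  have hcζ : c * ζ = 1 := (sub_eq_zero.mp hzero).symm
  have hζ : ζ ≠ 0 := right_ne_zero_of_mul_eq_one hcζ
  have hinv : Tendsto (·⁻¹) (𝓝[≠] ζ) (𝓝[≠] c) := by
    rw [eq_inv_of_mul_eq_one_left hcζ]
    exact (continuousAt_inv₀ hζ).continuousWithinAt.tendsto_nhdsWithin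
      fun ξ hξ => inv_injective.ne hξ
  rw [accPt_iff_frequently_nhdsNE, not_frequently]
  filter_upwards [hinv.eventually h, nhdsWithin_le_nhds (isOpen_ne.mem_nhds hζ)] with ξ hξ hξ0
  simpa using (isUnit_one_sub_smul_iff (inv_ne_zero hξ0) a).mp hξ

variable {H : Type*} [NormedAddCommGroup H] [InnerProductSpace ℂ H] [CompleteSpace H]

/-- The junk value `0⁻¹ = 0` makes `ζ ↦ (1 - c ζ)⁻¹` continuous on `σ(R)`, where `c⁻¹` is isolated,
and a generalized inverse of `ζ ↦ 1 - c ζ`. -/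
theorem exists_mul_mul_self_of_eventually_isUnit {R : H →L[ℂ] H} (hR : IsStarNormal R) {c : ℂ}
    (h : ∀ᶠ c' in 𝓝[≠] c, IsUnit (1 - c' • R)) :
    ∃ B : H →L[ℂ] H, (1 - c • R) * B * (1 - c • R) = 1 - c • R := by
  have hlin : cfc (fun ζ : ℂ => 1 - c * ζ) R = 1 - c • R := by
    rw [cfc_sub (a := R) (fun _ => 1) (fun ζ => c * ζ), cfc_const_one ℂ R, cfc_const_mul_id c R]
  have hcont := continuousOn_inv_one_sub_mul_spectrum h
  refine ⟨cfc (fun ζ : ℂ => (1 - c * ζ)⁻¹) R, ?_⟩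
  rw [← hlin, ← cfc_mul _ _ R (by fun_prop) hcont, ← cfc_mul _ _ R (by fun_prop) (by fun_prop)]
  simp only [mul_inv_mul_cancel]

theorem isLeftFredholm_one_sub_smul_iff {R : H →L[ℂ] H} (hR : IsStarNormal R) (c : ℂ) :
    IsLeftFredholm (1 - c • R) ↔
      (∀ᶠ c' in 𝓝[≠] c, IsUnit (1 - c' • R)) ∧ FiniteDimensional ℂ (1 - c • R).ker := by
  refine ⟨fun h => ⟨h.eventually_isUnit_one_sub_smul hR, h.finiteDimensional_ker⟩, ?_⟩
  rintro ⟨hunit, hfin⟩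
  obtain ⟨B, hB⟩ := exists_mul_mul_self_of_eventually_isUnit hR hunit
  exact isLeftFredholm_of_comp_comp_self hB

end Isolated

section Resolvent

variable {H : Type*} [NormedAddCommGroup H] [InnerProductSpace ℂ H] {S T T' : H →ₗ.[ℂ] H}
  {w z : ℂ} {R R' : H →L[ℂ] H}

theorem isResolventAt_iff_mem_graph_iff :
    IsResolventAt T w R ↔ ∀ x y, (x, y) ∈ T.graph ↔ R (y - w • x) = x := by
  constructor
  · intro hR x y
    refine ⟨fun hxy => ?_, fun hx => ?_⟩
    · obtain ⟨u, rfl, rfl⟩ := (LinearPMap.mem_graph_iff T).mp hxy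
      exact hR.2 u
    · obtain ⟨hdom, hTR⟩ := hR.1 (y - w • x)
      simp only [hx] at hdom hTR
      exact (LinearPMap.mem_graph_iff T).mpr ⟨⟨x, hdom⟩, rfl, sub_left_injective hTR⟩
  · refine fun h => ⟨fun y => ?_, fun x => (h x (T x)).mp (T.mem_graph x)⟩
    have hy : (R y, y + w • R y) ∈ T.graph := (h _ _).mpr (by rw [add_sub_cancel_right])
    obtain ⟨⟨x, hx⟩, hxR, hTx⟩ := (LinearPMap.mem_graph_iff T).mp hy
    obtain rfl : x = R y := hxR
    exact ⟨hx, sub_eq_of_eq_add hTx⟩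

theorem IsResolventAt.mem_graph_iff (hR : IsResolventAt T w R) {x y : H} :
    (x, y) ∈ T.graph ↔ R (y - w • x) = x :=
  isResolventAt_iff_mem_graph_iff.mp hR x y

theorem IsResolventAt.apply_mem_graph (hR : IsResolventAt T w R) (y : H) :
    (R y, y + w • R y) ∈ T.graph := by
  rw [hR.mem_graph_iff, add_sub_cancel_right]

theorem IsResolventAt.unique (hR : IsResolventAt T w R) (hR' : IsResolventAt T w R') : R = R' :=
  hR.eq_resolvent.trans hR'.eq_resolvent.symm

theorem IsResolventAt.eq_of_isResolventAt (hT : IsResolventAt T w R) (hT' : IsResolventAt T' w R) :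
    T = T' := by
  refine LinearPMap.eq_of_eq_graph (Submodule.ext fun ⟨x, y⟩ => ?_)
  rw [hT.mem_graph_iff, hT'.mem_graph_iff]

theorem IsResolventAt.le_iff (hR : IsResolventAt T w R) :
    S ≤ T ↔ ∀ x : S.domain, R (S x - w • (x : H)) = x := by
  rw [← LinearPMap.le_graph_iff]
  refine ⟨fun h x => hR.mem_graph_iff.mp (h (S.mem_graph x)), ?_⟩
  rintro h ⟨x, y⟩ hxy
  obtain ⟨u, rfl, rfl⟩ := (LinearPMap.mem_graph_iff S).mp hxy
  exact hR.mem_graph_iff.mpr (h u)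

theorem exists_isResolventAt (w : ℂ) (hR : Function.Injective R) :
    ∃ T : H →ₗ.[ℂ] H, IsResolventAt T w R := by
  let g : Submodule ℂ (H × H) := LinearMap.eqLocus
    (R.toLinearMap ∘ₗ (LinearMap.snd ℂ H H - w • LinearMap.fst ℂ H H)) (LinearMap.fst ℂ H H)
  have hg : ∀ p ∈ g, p.1 = 0 → p.2 = 0 := by
    rintro ⟨x, y⟩ hxy rfl
    have hRy : R (y - w • 0) = R 0 := hxy.trans R.map_zero.symm
    simpa using hR hRy
  refine ⟨g.toLinearPMap, isResolventAt_iff_mem_graph_iff.mpr fun x y => ?_⟩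
  rw [Submodule.toLinearPMap_graph_eq g hg]
  rfl

theorem mem_kerSub_iff {x : H} : x ∈ kerSub T z ↔ (x, z • x) ∈ T.graph := by
  rw [LinearPMap.mem_graph_iff]
  constructor
  · rintro ⟨hx, hTx⟩
    exact ⟨⟨x, hx⟩, rfl, hTx⟩
  · rintro ⟨u, rfl, hTu⟩
    exact ⟨u.2, hTu⟩

theorem IsResolventAt.kerSub_eq (hR : IsResolventAt T w R) (z : ℂ) :
    kerSub T z = (1 - (z - w) • R).ker := by
  ext x
  rw [mem_kerSub_iff, hR.mem_graph_iff, ← sub_smul, map_smul, LinearMap.mem_ker, eq_comm,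
    ← sub_eq_zero]
  rfl

theorem IsResolventAt.sub_eq_smul_mul (hR : IsResolventAt T w R) (hR' : IsResolventAt T z R') :
    R' - R = (z - w) • (R * R') := by
  ext y
  have hy := hR.mem_graph_iff.mp (hR'.apply_mem_graph y)
  rw [add_sub_assoc, ← sub_smul, map_add, map_smul] at hy
  exact sub_eq_of_eq_add' hy.symm

theorem IsResolventAt.commute (hR : IsResolventAt T w R) (hR' : IsResolventAt T z R') :
    Commute R R' := by
  rcases eq_or_ne z w with rfl | hne
  · rw [hR.unique hR']
  have hsymm : (z - w) • (R * R') = (z - w) • (R' * R) := by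
    rw [← hR.sub_eq_smul_mul hR', ← neg_sub R, hR'.sub_eq_smul_mul hR, ← neg_smul, neg_sub]
  exact smul_right_injective _ (sub_ne_zero.mpr hne) hsymm

theorem IsResolventAt.mem_resolventSet_iff (hR : IsResolventAt T w R) :
    z ∈ resolventSet T ↔ IsUnit (1 - (z - w) • R) := by
  constructor
  · rintro ⟨R', hR'⟩
    have hmul : (1 - (z - w) • R) * (1 + (z - w) • R') = 1 := by
      have hid := hR.sub_eq_smul_mul hR'
      rw [mul_add, mul_one, sub_mul, one_mul, smul_mul_smul_comm, mul_smul, ← hid, smul_sub]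
      abel
    have hcomm : Commute (1 - (z - w) • R) (1 + (z - w) • R') :=
      .sub_left (.one_left _) (.add_right (.one_right _)
        (((hR.commute hR').smul_left _).smul_right _))
    exact (hcomm.isUnit_mul_iff.mp (by rw [hmul]; exact isUnit_one)).1
  · rintro ⟨U, hU⟩
    refine ⟨↑U⁻¹ * R, isResolventAt_iff_mem_graph_iff.mpr fun x y => ?_⟩
    have hUx : (U : H →L[ℂ] H) x = x - (z - w) • R x := by rw [hU]; rfl
    have hinv : (↑U⁻¹ * R) (y - z • x) = x ↔ R (y - z • x) = (U : H →L[ℂ] H) x := by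
      constructor
      · intro h
        rw [← h, ← mul_apply_eq_comp, ← mul_assoc, U.mul_inv, one_mul, h]
      · intro h
        rw [mul_apply_eq_comp, h, ← mul_apply_eq_comp, U.inv_mul, one_apply_eq_self]
    have hyx : y - w • x = y - z • x + (z - w) • x := by rw [sub_smul]; abel
    rw [hR.mem_graph_iff, hinv, hUx, hyx, map_add, map_smul, eq_sub_iff_add_eq]

theorem IsResolventAt.isCompactOperator (hR : IsResolventAt T w R) (hR' : IsResolventAt T z R')
    (hcompact : IsCompactOperator R) : IsCompactOperator R' := by
  rw [← sub_add_cancel R' R, hR.sub_eq_smul_mul hR']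
  exact ((hcompact.comp_clm R').smul (z - w)).add hcompact

theorem HasCompactResolvent.isCompactOperator (hT : HasCompactResolvent T)
    (hR : IsResolventAt T w R) : IsCompactOperator R := by
  obtain ⟨z, hz, hcompact⟩ := hT
  exact (isResolventAt_resolvent hz).isCompactOperator hR hcompact

theorem isOpen_resolventSet [CompleteSpace H] (T : H →ₗ.[ℂ] H) : IsOpen (resolventSet T) := by
  rw [isOpen_iff_mem_nhds]
  rintro w ⟨R, hR⟩
  have hcont : Continuous fun z : ℂ => 1 - (z - w) • R := by fun_prop
  filter_upwards [hcont.continuousAt.preimage_mem_nhds (Units.isOpen.mem_nhds (by simp))] with z hz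
  exact hR.mem_resolventSet_iff.mpr hz

theorem mem_ranSub_iff {y : H} : y ∈ ranSub S z ↔ ∃ x : S.domain, S x - z • (x : H) = y :=
  Iff.rfl

theorem isClosed_ranSub (hS : S.IsClosed) (hR : IsResolventAt T w R) (hST : S ≤ T) :
    IsClosed (ranSub S w : Set H) := by
  have hSR := hR.le_iff.mp hST
  have hmem : ∀ y, y ∈ ranSub S w ↔ (R y, y + w • R y) ∈ S.graph := by
    intro y
    rw [mem_ranSub_iff, LinearPMap.mem_graph_iff]
    constructor
    · rintro ⟨x, rfl⟩
      exact ⟨x, (hSR x).symm, by rw [hSR, sub_add_cancel]⟩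
    · rintro ⟨x, hx, hSx⟩
      exact ⟨x, by rw [hSx, hx, add_sub_cancel_right]⟩
  have hpre : (ranSub S w : Set H) = (fun y => (R y, y + w • R y)) ⁻¹' S.graph := Set.ext hmem
  rw [hpre]
  exact hS.preimage (by fun_prop)

theorem IsResolventAt.eventually_mem_resolventSet_iff (hR : IsResolventAt T w R) (z : ℂ) :
    (∀ᶠ z' in 𝓝[≠] z, z' ∈ resolventSet T) ↔ ∀ᶠ c in 𝓝[≠] (z - w), IsUnit (1 - c • R) := by
  rw [← map_subRight_nhdsNE, eventually_map]
  simp only [hR.mem_resolventSet_iff]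

end Resolvent

section EssentialSpectrum

variable {H : Type*} [NormedAddCommGroup H] [InnerProductSpace ℂ H] {T : H →ₗ.[ℂ] H}
  {w z : ℂ} {R : H →L[ℂ] H}

theorem exists_nhds_inter_spec_eq_singleton_iff (hz : z ∈ spec T) :
    (∃ N ∈ 𝓝 z, N ∩ spec T = {z}) ↔ ∀ᶠ z' in 𝓝[≠] z, z' ∈ resolventSet T := by
  rw [eventually_nhdsWithin_iff]
  constructor
  · rintro ⟨N, hN, hNz⟩
    filter_upwards [hN] with z' hz' hne
    by_contra hspec
    exact hne (hNz.subset ⟨hz', hspec⟩)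
  · refine fun h => ⟨_, h, Set.Subset.antisymm ?_ ?_⟩
    · rintro z' ⟨himp, hspec⟩
      exact not_not.mp fun hne => hspec (himp hne)
    · rintro _ rfl
      exact ⟨fun hne => absurd rfl hne, hz⟩

variable [CompleteSpace H]

theorem IsResolventAt.notMem_essSpec_iff (hR : IsResolventAt T w R) (hnormal : IsStarNormal R)
    (z : ℂ) : z ∉ essSpec T ↔ IsLeftFredholm (1 - (z - w) • R) := by
  by_cases hz : z ∈ resolventSet T
  · exact iff_of_true (fun h => h.1 hz) (.of_isUnit (hR.mem_resolventSet_iff.mp hz))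
  have hdisc : z ∉ essSpec T ↔ z ∈ discSpec T := by
    rw [essSpec, Set.mem_sdiff, not_and_not_right]
    exact ⟨fun h => h hz, fun h _ => h⟩
  have hiff := isLeftFredholm_one_sub_smul_iff hnormal (z - w)
  rw [← hR.eventually_mem_resolventSet_iff, ← hR.kerSub_eq] at hiff
  rw [hdisc, hiff]
  refine ⟨fun h => ⟨(exists_nhds_inter_spec_eq_singleton_iff hz).mp h.2.1, h.2.2.2⟩, fun h => ?_⟩
  refine ⟨hz, (exists_nhds_inter_spec_eq_singleton_iff hz).mpr h.1, fun hker => hz ?_, h.2⟩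
  rw [hR.kerSub_eq, LinearMap.ker_eq_bot] at hker
  exact hR.mem_resolventSet_iff.mpr ((hiff.mpr h).isUnit_of_injective inferInstance hker)

theorem IsResolventAt.essSpec_eq {G : Type*} [NormedAddCommGroup G] [InnerProductSpace ℂ G]
    [CompleteSpace G] {Θ : G →ₗ.[ℂ] G} {C : G →L[ℂ] G} {V : G →L[ℂ] H} {W : H →L[ℂ] G}
    (hR : IsResolventAt T w R) (hRnormal : IsStarNormal R)
    (hC : IsResolventAt Θ w C) (hCnormal : IsStarNormal C) (hWV : W ∘L V = 1)
    (hcompact : IsCompactOperator (R - V ∘L C ∘L W : H →L[ℂ] H)) : essSpec T = essSpec Θ := by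
  ext z
  rw [← not_iff_not, hR.notMem_essSpec_iff hRnormal, hC.notMem_essSpec_iff hCnormal]
  have hperturb : 1 - (z - w) • R - (1 - V ∘L ((z - w) • C ∘L W)) =
      -(z - w) • (R - V ∘L C ∘L W) := by
    simp only [comp_smul, smul_sub, neg_smul]
    abel
  have hcorner : ((z - w) • C ∘L W) ∘L V = (z - w) • C := by
    rw [smul_comp, comp_assoc, hWV, one_def, comp_id]
  have hcpt : IsCompactOperator (1 - (z - w) • R - (1 - V ∘L ((z - w) • C ∘L W)) : H →L[ℂ] H) := by
    rw [hperturb]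
    exact hcompact.smul _
  rw [isLeftFredholm_congr hcpt, isLeftFredholm_one_sub_comp_comm, hcorner]

end EssentialSpectrum

section SelfAdjoint

variable {H : Type*} [NormedAddCommGroup H] [InnerProductSpace ℂ H] [CompleteSpace H]
  {S T : H →ₗ.[ℂ] H} {w z : ℂ} {R : H →L[ℂ] H}

theorem IsResolventAt.adjoint (hR : IsResolventAt T w R) (hT : Dense (T.domain : Set H)) :
    IsResolventAt T.adjoint (star w) (star R) := by
  refine isResolventAt_iff_mem_graph_iff.mpr fun x y => ?_
  rw [LinearPMap.adjoint_graph_eq_graph_adjoint hT, Submodule.mem_adjoint_iff, star_eq_adjoint]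
  have hinner : ∀ h : H, inner ℂ (h + w • R h) x - inner ℂ (R h) y =
      inner ℂ h x - inner ℂ h (ContinuousLinearMap.adjoint R (y - star w • x)) := by
    intro h
    rw [adjoint_inner_right, inner_sub_right, inner_add_left, inner_smul_left, inner_smul_right]
    change _ + star w * _ - _ = _
    ring
  constructor
  · refine fun h => ext_inner_left ℂ fun v => ?_
    rw [eq_comm, ← sub_eq_zero, ← hinner]
    exact h _ _ (hR.apply_mem_graph v)
  · intro h a b hab
    have hRa := hR.mem_graph_iff.mp hab
    have hb := hinner (b - w • a)
    rwa [hRa, sub_add_cancel, h, sub_self] at hb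

theorem IsResolventAt.isStarNormal (hR : IsResolventAt T w R) (hT : IsSelfAdjoint T) :
    IsStarNormal R := by
  have hstar := hR.adjoint hT.dense_domain
  rw [LinearPMap.isSelfAdjoint_def.mp hT] at hstar
  exact ⟨hstar.commute hR⟩

theorem IsResolventAt.isSelfAdjoint_iff {μ : ℝ} (hR : IsResolventAt T μ R)
    (hT : Dense (T.domain : Set H)) : IsSelfAdjoint T ↔ IsSelfAdjoint R := by
  have hstar := hR.adjoint hT
  rw [Complex.star_def, Complex.conj_ofReal] at hstar
  rw [LinearPMap.isSelfAdjoint_def]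
  constructor
  · intro hadj
    rw [hadj] at hstar
    exact hstar.unique hR
  · intro hstarR
    rw [hstarR.star_eq] at hstar
    exact hstar.eq_of_isResolventAt hR

/-- The kernel of `R` is orthogonal to its range, which contains `dom S`. Hence `R` is injective,
that is, a resolvent. -/
theorem exists_isSelfAdjoint_isResolventAt {μ : ℝ} (hS : Dense (S.domain : Set H))
    (hR : IsSelfAdjoint R) (hSR : ∀ x : S.domain, R (S x - (μ : ℂ) • (x : H)) = x) :
    ∃ A : H →ₗ.[ℂ] H, IsSelfAdjoint A ∧ S ≤ A ∧ IsResolventAt A μ R := by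
  have hrange : Dense (R.range : Set H) := hS.mono fun x hx => ⟨_, hSR ⟨x, hx⟩⟩
  have hinj : Function.Injective R := by
    rw [← coe_coe, ← LinearMap.ker_eq_bot, ← hR.isStarNormal.orthogonal_range]
    exact (Submodule.topologicalClosure_eq_top_iff).mp
      (Submodule.dense_iff_topologicalClosure_eq_top.mp hrange)
  obtain ⟨A, hA⟩ := exists_isResolventAt (μ : ℂ) hinj
  have hSA : S ≤ A := hA.le_iff.mpr hSR
  exact ⟨A, (hA.isSelfAdjoint_iff (hS.mono hSA.1)).mpr hR, hSA, hA⟩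

theorem mem_resolventSet_of_im_ne_zero {μ : ℝ} (hT : IsSelfAdjoint T)
    (hμ : (μ : ℂ) ∈ resolventSet T) (hz : z.im ≠ 0) : z ∈ resolventSet T := by
  obtain ⟨R, hR⟩ := hμ
  have hsub : (z - μ).im ≠ 0 := by rwa [Complex.sub_im, Complex.ofReal_im, sub_zero]
  have hne : z - μ ≠ 0 := fun h => hsub (by rw [h, Complex.zero_im])
  rw [hR.mem_resolventSet_iff, isUnit_one_sub_smul_iff hne]
  intro hspec
  have him := ((hR.isSelfAdjoint_iff hT.dense_domain).mp hT).im_eq_zero_of_mem_spectrum hspec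
  rw [Complex.inv_im, div_eq_zero_iff, neg_eq_zero, Complex.normSq_eq_zero] at him
  exact him.elim hsub hne

theorem HasCompactResolvent.eventually_mem_resolventSet (hcompact : HasCompactResolvent T)
    (hT : IsSelfAdjoint T) (z : ℂ) : ∀ᶠ z' in 𝓝[≠] z, z' ∈ resolventSet T := by
  obtain ⟨w, ⟨R, hR⟩, -⟩ := id hcompact
  have hRcompact := hcompact.isCompactOperator hR
  rw [hR.eventually_mem_resolventSet_iff]
  refine IsLeftFredholm.eventually_isUnit_one_sub_smul (hR.isStarNormal hT) ?_
  refine (IsLeftFredholm.of_isUnit isUnit_one).of_isCompactOperator_sub ?_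
  rw [sub_sub_cancel_left]
  exact (hRcompact.smul (z - w)).neg

theorem HasCompactResolvent.exists_real_mem_resolventSet (hcompact : HasCompactResolvent T)
    (hT : IsSelfAdjoint T) {O : Set ℂ} (hO : IsOpen O) {μ : ℝ} (hμ : (μ : ℂ) ∈ O) :
    ∃ μ' : ℝ, (μ' : ℂ) ∈ resolventSet T ∧ (μ' : ℂ) ∈ O := by
  have hreal : Tendsto ((↑) : ℝ → ℂ) (𝓝[≠] μ) (𝓝[≠] (μ : ℂ)) :=
    Complex.continuous_ofReal.continuousWithinAt.tendsto_nhdsWithin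
      fun _ hne => Complex.ofReal_injective.ne hne
  have hboth : ∀ᶠ z in 𝓝[≠] (μ : ℂ), z ∈ resolventSet T ∧ z ∈ O :=
    (hcompact.eventually_mem_resolventSet hT μ).and (nhdsWithin_le_nhds (hO.mem_nhds hμ))
  exact (hreal.eventually hboth).exists

end SelfAdjoint

section DefectSpace

variable {H : Type*} [NormedAddCommGroup H] [InnerProductSpace ℂ H] {S A T : H →ₗ.[ℂ] H}
  {w z : ℂ}

theorem rank_kerSub_le (hAT : A ≤ T) (hw : w ∈ resolventSet A) (hz : z ∈ resolventSet A) :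
    Module.rank ℂ (kerSub T z) ≤ Module.rank ℂ (kerSub T w) := by
  obtain ⟨R, hR⟩ := hw
  have hgraph := LinearPMap.le_graph_of_le hAT
  have hmaps : ∀ x ∈ kerSub T z, (1 - (z - w) • R) x ∈ kerSub T w := by
    intro x hx
    rw [mem_kerSub_iff] at hx ⊢
    have hdiff := T.graph.sub_mem hx (T.graph.smul_mem (z - w) (hgraph (hR.apply_mem_graph x)))
    convert hdiff using 1
    refine Prod.ext rfl ?_
    change w • (x - (z - w) • R x) = z • x - (z - w) • (x + w • R x)
    module
  obtain ⟨V, hV⟩ := (hR.mem_resolventSet_iff.mp hz).exists_left_inv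
  have hinj : Function.Injective (1 - (z - w) • R : H →L[ℂ] H) :=
    Function.LeftInverse.injective (g := V) fun x => congrArg (fun L : H →L[ℂ] H => L x) hV
  exact LinearMap.rank_le_of_injective
    ((1 - (z - w) • R).toLinearMap.restrict hmaps)
    fun x y hxy => Subtype.ext (hinj (congrArg Subtype.val hxy))

variable [CompleteSpace H]

theorem adjoint_le_adjoint (hS : Dense (S.domain : Set H)) (hST : S ≤ T) :
    T.adjoint ≤ S.adjoint := by
  rw [← LinearPMap.le_graph_iff, LinearPMap.adjoint_graph_eq_graph_adjoint hS,
    LinearPMap.adjoint_graph_eq_graph_adjoint (hS.mono hST.1)]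
  intro p hp
  rw [Submodule.mem_adjoint_iff] at hp ⊢
  exact fun a b hab => hp a b (LinearPMap.le_graph_of_le hST hab)

theorem kerSub_adjoint (hS : Dense (S.domain : Set H)) (z : ℂ) :
    kerSub S.adjoint z = (ranSub S (star z))ᗮ := by
  ext x
  rw [mem_kerSub_iff, LinearPMap.adjoint_graph_eq_graph_adjoint hS, Submodule.mem_adjoint_iff,
    Submodule.mem_orthogonal]
  have hinner : ∀ u : S.domain, inner ℂ (S u - star z • (u : H)) x =
      inner ℂ (S u) x - inner ℂ (u : H) (z • x) := by
    intro u
    rw [inner_sub_left, inner_smul_left, inner_smul_right, Complex.star_def, Complex.conj_conj]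
  constructor
  · rintro h _ ⟨u, rfl⟩
    exact (hinner u).trans (h u (S u) (S.mem_graph u))
  · intro h a b hab
    obtain ⟨u, rfl, rfl⟩ := (LinearPMap.mem_graph_iff S).mp hab
    exact (hinner u).symm.trans (h _ (mem_ranSub_iff.mpr ⟨u, rfl⟩))

theorem not_finiteDimensional_kerSub_of_deficiencyIndex_eq_top (hA : IsSelfAdjoint A)
    (hS : Dense (S.domain : Set H)) (hSA : S ≤ A) (hw : w ∈ resolventSet A)
    (hz : z ∈ resolventSet A) (hdef : deficiencyIndex S z = ⊤) :
    ¬ FiniteDimensional ℂ (kerSub S.adjoint w) := by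
  intro hfin
  have hAS : A ≤ S.adjoint :=
    (LinearPMap.isSelfAdjoint_def.mp hA).ge.trans (adjoint_le_adjoint hS hSA)
  have hrank := rank_kerSub_le hAS hw hz
  rw [deficiencyIndex, Cardinal.toENat_eq_top] at hdef
  exact (hdef.trans hrank).not_gt (Module.rank_lt_aleph0 ℂ _)

theorem isOrtho_kerSub_adjoint_ranSub (hS : Dense (S.domain : Set H)) (μ : ℝ) :
    kerSub S.adjoint μ ⟂ ranSub S μ := by
  rw [kerSub_adjoint hS, Complex.star_def, Complex.conj_ofReal]
  exact Submodule.isOrtho_orthogonal_left _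

theorem isCompl_kerSub_adjoint_ranSub (hS : Dense (S.domain : Set H)) {μ : ℝ}
    (hclosed : IsClosed (ranSub S μ : Set H)) : IsCompl (kerSub S.adjoint μ) (ranSub S μ) := by
  have : CompleteSpace (ranSub S μ) := hclosed.completeSpace_coe
  rw [kerSub_adjoint hS, Complex.star_def, Complex.conj_ofReal]
  exact (ranSub S μ).isCompl_orthogonal.symm

end DefectSpace

section Separable

variable {𝕜 H G : Type*} [RCLike 𝕜] [NormedAddCommGroup H] [InnerProductSpace 𝕜 H]
  [TopologicalSpace.SeparableSpace H] [NormedAddCommGroup G] [InnerProductSpace 𝕜 G]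
  [TopologicalSpace.SeparableSpace G]

theorem countable_of_orthonormal {ι : Type*} {v : ι → H} (hv : Orthonormal 𝕜 v) : Countable ι := by
  refine Pairwise.countable_of_isOpen_disjoint (s := fun i => Metric.ball (v i) (1 / 2)) ?_
    (fun _ => Metric.isOpen_ball) fun i => ⟨v i, Metric.mem_ball_self one_half_pos⟩
  intro i j hij
  refine Metric.ball_disjoint_ball ?_
  have hsq : ‖v i - v j‖ ^ 2 = 2 := by
    rw [norm_sub_sq (𝕜 := 𝕜), hv.1, hv.1, hv.2 hij, map_zero]
    norm_num
  rw [dist_eq_norm, add_halves]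
  exact (one_le_sq_iff₀ (norm_nonneg _)).mp (by rw [hsq]; exact one_le_two)

theorem nonempty_hilbertBasis_nat [CompleteSpace H] (hH : ¬ FiniteDimensional 𝕜 H) :
    Nonempty (HilbertBasis ℕ 𝕜 H) := by
  obtain ⟨s, b, -⟩ := exists_hilbertBasis 𝕜 H
  have hcountable : Countable s := countable_of_orthonormal b.orthonormal
  have hinfinite : Infinite s := by
    rw [← not_finite_iff_infinite]
    intro hfinite
    have := Fintype.ofFinite s
    exact hH b.toOrthonormalBasis.toBasis.finiteDimensional_of_finite
  obtain ⟨e⟩ := nonempty_equiv_of_countable (α := ℕ) (β := s)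
  exact ⟨HilbertBasis.mk (b.orthonormal.comp e e.injective)
    (by rw [e.surjective.range_comp, b.dense_span])⟩

theorem nonempty_linearIsometryEquiv [CompleteSpace H] [CompleteSpace G]
    (hG : ¬ FiniteDimensional 𝕜 G) (hH : ¬ FiniteDimensional 𝕜 H) : Nonempty (G ≃ₗᵢ[𝕜] H) := by
  obtain ⟨b⟩ := nonempty_hilbertBasis_nat hG
  obtain ⟨b'⟩ := nonempty_hilbertBasis_nat hH
  exact ⟨b.repr.trans b'.repr.symm⟩

end Separable

theorem nonempty_linearIsometryEquiv_kerSub_adjoint {H G : Type*} [NormedAddCommGroup H]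
    [InnerProductSpace ℂ H] [CompleteSpace H] [TopologicalSpace.SeparableSpace H]
    [NormedAddCommGroup G] [InnerProductSpace ℂ G] [CompleteSpace G]
    [TopologicalSpace.SeparableSpace G] (hG : ¬ FiniteDimensional ℂ G) {S A : H →ₗ.[ℂ] H}
    {w z : ℂ} (hA : IsSelfAdjoint A) (hS : Dense (S.domain : Set H)) (hSA : S ≤ A)
    (hw : w ∈ resolventSet A) (hz : z ∈ resolventSet A) (hdef : deficiencyIndex S z = ⊤) :
    Nonempty (G ≃ₗᵢ[ℂ] kerSub S.adjoint w) := by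
  have hclosed : IsClosed (kerSub S.adjoint w : Set H) := by
    rw [kerSub_adjoint hS]
    exact Submodule.isClosed_orthogonal _
  have : CompleteSpace (kerSub S.adjoint w) := hclosed.completeSpace_coe
  exact nonempty_linearIsometryEquiv hG
    (not_finiteDimensional_kerSub_of_deficiencyIndex_eq_top hA hS hSA hw hz hdef)

section CornerBlock

variable {H G : Type*} [NormedAddCommGroup H] [InnerProductSpace ℂ H] [NormedAddCommGroup G]
  [InnerProductSpace ℂ G] {K L : Submodule ℂ H}

/-- A unitary `U : G → K` onto a subspace `K`, as an isometry `V : G → H`. The corner block of `B`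
is then `V B V†`. -/
noncomputable def subspaceIsometry (U : G ≃ₗᵢ[ℂ] K) : G →L[ℂ] H :=
  (K.subtypeₗᵢ.comp U.toLinearIsometry).toContinuousLinearMap

variable [CompleteSpace H] [CompleteSpace G]

theorem adjoint_subspaceIsometry_comp_self (U : G ≃ₗᵢ[ℂ] K) :
    adjoint (subspaceIsometry U) ∘L subspaceIsometry U = 1 :=
  (norm_map_iff_adjoint_comp_self _).mp U.norm_map

theorem adjoint_subspaceIsometry_eq_zero (U : G ≃ₗᵢ[ℂ] K) (hKL : K ⟂ L) {l : H} (hl : l ∈ L) :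
    adjoint (subspaceIsometry U) l = 0 := by
  refine ext_inner_left ℂ fun g => ?_
  rw [adjoint_inner_right, inner_zero_right]
  exact hKL.inner_eq (U g).2 hl

theorem isCornerBlock_comp_adjoint (U : G ≃ₗᵢ[ℂ] K) (hKL : K ⟂ L) (B : G →L[ℂ] G) :
    IsCornerBlock K L U B (subspaceIsometry U ∘L B ∘L adjoint (subspaceIsometry U)) := by
  constructor
  · intro k
    have hk : subspaceIsometry U (U.symm k) = k := congrArg Subtype.val (U.apply_symm_apply k)
    have hVk : adjoint (subspaceIsometry U) k = U.symm k := by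
      rw [← hk, ← comp_apply, adjoint_subspaceIsometry_comp_self, one_apply_eq_self]
    rw [comp_apply, comp_apply, hVk]
    rfl
  · intro l hl
    rw [comp_apply, comp_apply, adjoint_subspaceIsometry_eq_zero U hKL hl, map_zero, map_zero]

theorem exists_isSelfAdjoint_extension_cornerBlock {S A₀ : H →ₗ.[ℂ] H} {Θ : G →ₗ.[ℂ] G}
    {μ : ℝ} {R : H →L[ℂ] H} {C : G →L[ℂ] G} (hS : Dense (S.domain : Set H)) (hSA₀ : S ≤ A₀)
    (hA₀ : IsSelfAdjoint A₀) (hR : IsResolventAt A₀ μ R) (hcompact : IsCompactOperator R)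
    (hΘ : IsSelfAdjoint Θ) (hC : IsResolventAt Θ μ C) (hK : K ⟂ ranSub S μ) (U : G ≃ₗᵢ[ℂ] K) :
    ∃ (A : H →ₗ.[ℂ] H) (D : H →L[ℂ] H), IsSelfAdjoint A ∧ S ≤ A ∧
      IsCornerBlock K (ranSub S μ) U C D ∧ IsResolventAt A μ (R + D) ∧ essSpec A = essSpec Θ := by
  set V := subspaceIsometry U
  have hRsa := (hR.isSelfAdjoint_iff hA₀.dense_domain).mp hA₀
  have hCsa := (hC.isSelfAdjoint_iff hΘ.dense_domain).mp hΘ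
  have hD : IsCornerBlock K (ranSub S μ) U C (V ∘L C ∘L adjoint V) :=
    isCornerBlock_comp_adjoint U hK C
  have hsum : IsSelfAdjoint (R + V ∘L C ∘L adjoint V) := hRsa.add (hCsa.conj_adjoint V)
  have hext : ∀ x : S.domain,
      (R + V ∘L C ∘L adjoint V) (S x - (μ : ℂ) • (x : H)) = x := by
    intro x
    rw [add_apply, hR.le_iff.mp hSA₀ x, hD.2 _ (mem_ranSub_iff.mpr ⟨x, rfl⟩), add_zero]
  obtain ⟨A, hA, hSA, hAres⟩ := exists_isSelfAdjoint_isResolventAt hS hsum hext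
  refine ⟨A, _, hA, hSA, hD, hAres, ?_⟩
  refine hAres.essSpec_eq hsum.isStarNormal hC hCsa.isStarNormal
    (adjoint_subspaceIsometry_comp_self U) ?_
  rwa [add_sub_cancel_right]

end CornerBlock

end HilbertOp

theorem mainTheorem2
    {H : Type*} [NormedAddCommGroup H] [InnerProductSpace ℂ H] [CompleteSpace H]
    [TopologicalSpace.SeparableSpace H]
    {G : Type*} [NormedAddCommGroup G] [InnerProductSpace ℂ G] [CompleteSpace G]
    [TopologicalSpace.SeparableSpace G] (hG : ¬ FiniteDimensional ℂ G)
    (S : H →ₗ.[ℂ] H) (hSdense : Dense (S.domain : Set H)) (hSclosed : S.IsClosed)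
    (hSsymm : S.IsFormalAdjoint S)
    (hSdef : HilbertOp.deficiencyIndex S Complex.I = ⊤)
    (hSdef' : HilbertOp.deficiencyIndex S (-Complex.I) = ⊤)
    (hScompact : ∃ A₀ : H →ₗ.[ℂ] H, IsSelfAdjoint A₀ ∧ S ≤ A₀ ∧ HilbertOp.HasCompactResolvent A₀)
    (Ξ : G →ₗ.[ℂ] G) (hΞ : IsSelfAdjoint Ξ)
    (hΞres : ∃ μ : ℝ, (μ : ℂ) ∈ HilbertOp.resolventSet Ξ) :
    (∃ A : H →ₗ.[ℂ] H, IsSelfAdjoint A ∧ S ≤ A ∧ HilbertOp.essSpec A = HilbertOp.essSpec Ξ) ∧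
    ∀ A₀ : H →ₗ.[ℂ] H, IsSelfAdjoint A₀ → S ≤ A₀ → HilbertOp.HasCompactResolvent A₀ →
      (∃ μ : ℝ, (μ : ℂ) ∈ HilbertOp.resolventSet A₀ ∧ (μ : ℂ) ∈ HilbertOp.resolventSet Ξ) ∧
      ∀ μ : ℝ, (μ : ℂ) ∈ HilbertOp.resolventSet A₀ → (μ : ℂ) ∈ HilbertOp.resolventSet Ξ →
        IsCompl (HilbertOp.kerSub S.adjoint μ) (HilbertOp.ranSub S μ) ∧
        HilbertOp.kerSub S.adjoint μ ⟂ HilbertOp.ranSub S μ ∧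
        Nonempty (G ≃ₗᵢ[ℂ] HilbertOp.kerSub S.adjoint μ) ∧
        ∀ U : G ≃ₗᵢ[ℂ] HilbertOp.kerSub S.adjoint μ,
          ∃ (A : H →ₗ.[ℂ] H) (D : H →L[ℂ] H),
            IsSelfAdjoint A ∧ S ≤ A ∧
            HilbertOp.IsCornerBlock (HilbertOp.kerSub S.adjoint μ) (HilbertOp.ranSub S μ) U
              (HilbertOp.resolvent Ξ μ) D ∧
            (μ : ℂ) ∈ HilbertOp.resolventSet A ∧
            HilbertOp.resolvent A μ = HilbertOp.resolvent A₀ μ + D ∧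
            HilbertOp.essSpec A = HilbertOp.essSpec Ξ := by
  refine (and_iff_right_of_imp fun hall => ?_).mpr fun A₀ hA₀ hSA₀ hcompact => ⟨?_, ?_⟩
  · obtain ⟨A₀, hA₀, hSA₀, hcompact⟩ := hScompact
    obtain ⟨⟨μ, hμ, hμΞ⟩, hconstr⟩ := hall A₀ hA₀ hSA₀ hcompact
    obtain ⟨-, -, ⟨U⟩, hext⟩ := hconstr μ hμ hμΞ
    obtain ⟨A, -, hA, hSA, -, -, -, hess⟩ := hext U
    exact ⟨A, hA, hSA, hess⟩
  · obtain ⟨μ, hμ⟩ := hΞres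
    exact hcompact.exists_real_mem_resolventSet hA₀ (HilbertOp.isOpen_resolventSet Ξ) hμ
  intro μ hμ hμΞ
  have hR := HilbertOp.isResolventAt_resolvent hμ
  have hC := HilbertOp.isResolventAt_resolvent hμΞ
  have hortho := HilbertOp.isOrtho_kerSub_adjoint_ranSub hSdense μ
  have hI := HilbertOp.mem_resolventSet_of_im_ne_zero hA₀ hμ (z := Complex.I) (by simp)
  have hU := HilbertOp.nonempty_linearIsometryEquiv_kerSub_adjoint hG hA₀ hSdense hSA₀ hμ hI hSdef
  refine ⟨HilbertOp.isCompl_kerSub_adjoint_ranSub hSdense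
    (HilbertOp.isClosed_ranSub hSclosed hR hSA₀), hortho, hU, fun U => ?_⟩
  obtain ⟨A, D, hA, hSA, hD, hAres, hess⟩ := HilbertOp.exists_isSelfAdjoint_extension_cornerBlock
    hSdense hSA₀ hA₀ hR (hcompact.isCompactOperator hR) hΞ hC hortho U
  exact ⟨A, D, hA, hSA, hD, ⟨_, hAres⟩, hAres.eq_resolvent.symm, hess⟩
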